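/- **Setting.** Let $X$ be a compact metric space with metric $d_X$, equipped with a Borel probability measure $\mu_X$ whose support is all of $X$. For a Borel set $A\subset X$ put $$\mu_X^+(A):=\limsup_{\varepsilon\to0+}\frac{\mu_X(U_\varepsilon(A))-\mu_X(A)}{\varepsilon}\in[0,+\infty],$$ where $U_\varepsilon(A)$ is the open $\varepsilon$-neighbourhood of $A$, and for $v\in\operatorname{Im}\mu_X:=\{\mu_X(A)\mid A\subset X\text{ Borel}\}$ put $I_X(v):=\inf\{\mu_X^+(A)\mid A\subset X\text{ Borel},\ \mu_X(A)=v\}$. A minimal geodesic joining $p$ and $q$ is a curve $\gamma:[0,d_X(p,q)]\to X$ from $p$ to $q$ with $d_X(\gamma(s),\gamma(t))=|s-t|$ for all $s,t$. Let $\mathcal V$ be the set of Borel probability measures on $\mathbb R$ that are absolutely continuous with respect to the Lebesgue measure $\mathcal L^1$ and have connected support. For a strictly increasing continuous function $\lambda:[0,\infty)\to[0,\infty)$ put $$\operatorname{Var}_\lambda(\nu):=\int_{\mathbb R}\int_{\mathbb R}\lambda(|x-x'|)\,d\nu(x)\,d\nu(x'),\qquad \operatorname{ObsVar}_\lambda(X):=\sup_f\int_X\int_X\lambda(|f(x)-f(x')|)\,d\mu_X(x)\,d\mu_X(x'),$$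 where $f$ runs over all $1$-Lipschitz functions $f:X\to\mathbb R$. **Theorem.** Assume in addition that $X$ is geodesic (any two points are joined by a minimal geodesic) and essentially connected, i.e. $\mu_X^+(A)>0$ for every closed $A\subset X$ with $0<\mu_X(A)<1$. Let $\nu\in\mathcal V$ have compact support and cumulative distribution function $V$, and assume that $X$ satisfies the isoperimetric comparison condition $\mathrm{IC}(\nu)$: $I_X\circ V\ge V'$ holds $\mathcal L^1$-almost everywhere on $V^{-1}(\operatorname{Im}\mu_X)$. Then $$\operatorname{diam}X\le\operatorname{diam}\operatorname{supp}\nu .$$ For every strictly increasing continuous $\lambda:[0,\infty)\to[0,\infty)$, equality $\operatorname{diam}X=\operatorname{diam}\operatorname{supp}\nu$ holds if and only if $\operatorname{ObsVar}_\lambda(X)=\operatorname{Var}_\lambda(\nu)$. In the equality case there are points $p,q\in X$ with $d_X(p,q)=\operatorname{diam}X$ such that every point of $X$ lies on a minimal geodesic joining $p$ and $q$; if moreover $X$ is non-branching (two minimal geodesics of the same length, parametrized by arclength, that agree on a nontrivial initial segment are equal), then $X$ is homeomorphic to the suspension of some topological space $Y$, i.e. to $Y\times[0,1]$ with $Y\times\{0\}$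 collapsed to one point and $Y\times\{1\}$ collapsed to another. -/

import Mathlib

open Set Filter Topology MeasureTheory
open scoped NNReal ENNReal

noncomputable section

/-- The curve `γ`, restricted to `[0, L]`, is a minimal geodesic parametrized by arclength. -/
def IsMinimalGeodesic {X : Type*} [MetricSpace X] (L : ℝ) (γ : ℝ → X) : Prop :=
  ∀ s ∈ Icc 0 L, ∀ t ∈ Icc 0 L, dist (γ s) (γ t) = |s - t|

/-- The curve `γ`, restricted to `[0, dist p q]`, is a minimal geodesic from `p` to `q`. -/
def IsMinimalGeodesicJoining {X : Type*} [MetricSpace X] (p q : X) (γ : ℝ → X) : Prop :=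
  IsMinimalGeodesic (dist p q) γ ∧ γ 0 = p ∧ γ (dist p q) = q

/-- `X` is a geodesic space: any two points are joined by a minimal geodesic. -/
def IsGeodesicSpace (X : Type*) [MetricSpace X] : Prop :=
  ∀ p q : X, ∃ γ : ℝ → X, IsMinimalGeodesicJoining p q γ

/-- `X` is non-branching: two minimal geodesics of the same length that agree on a nontrivial
initial segment are equal. -/
def IsNonBranching (X : Type*) [MetricSpace X] : Prop :=
  ∀ (L : ℝ) (γ σ : ℝ → X), IsMinimalGeodesic L γ → IsMinimalGeodesic L σ →
    ∀ a ∈ Ioo 0 L, (∀ t ∈ Icc 0 a, γ t = σ t) → ∀ t ∈ Icc 0 L, γ t = σ t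

/-- The (unreduced) suspension of `Y`: the quotient space of `Y × [0, 1]` in which `Y × {0}` is
collapsed to one point and `Y × {1}` to another. -/
abbrev Suspension (Y : Type*) : Type _ :=
  Quot (fun a b : Y × unitInterval => (a.2 = 0 ∧ b.2 = 0) ∨ (a.2 = 1 ∧ b.2 = 1))

/-- `X` is homeomorphic to the suspension of some topological space. -/
def IsHomeomorphicToSuspension.{u} (X : Type u) [TopologicalSpace X] : Prop :=
  ∃ (Y : Type u) (_ : TopologicalSpace Y), Nonempty (X ≃ₜ Suspension Y)

/-- The boundary measure `μ⁺(A) = limsup_{ε → 0+} (μ(U_ε(A)) - μ(A)) / ε`, where `U_ε(A)` is the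
open `ε`-neighbourhood of `A`; its value may be `∞`. -/
def boundaryMeasure {X : Type*} [MetricSpace X] [MeasurableSpace X] (μ : Measure X)
    (A : Set X) : ℝ≥0∞ :=
  limsup (fun ε : ℝ => (μ (Metric.thickening ε A) - μ A) / ENNReal.ofReal ε) (𝓝[>] 0)

/-- The set of all values `μ(A)`, `A` Borel. -/
def measureImage {X : Type*} [MeasurableSpace X] (μ : Measure X) : Set ℝ :=
  {v | ∃ A : Set X, MeasurableSet A ∧ μ.real A = v}

/-- The isoperimetric profile `v ↦ inf {μ⁺(A) | A Borel, μ(A) = v}`; only its values on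
`measureImage μ` matter. -/
def isoperimetricProfile {X : Type*} [MetricSpace X] [MeasurableSpace X] (μ : Measure X)
    (v : ℝ) : ℝ≥0∞ :=
  ⨅ (A : Set X) (_ : MeasurableSet A) (_ : μ.real A = v), boundaryMeasure μ A

/-- The isoperimetric comparison condition `IC(ν)`: `I_X ∘ V ≥ V'` Lebesgue-a.e. on the preimage
under `V` of the set of values of `μ`, where `V` is the cumulative distribution function of `ν`.
(`V` is monotone, so `V'` exists almost everywhere and is nonnegative.) -/
def SatisfiesIC {X : Type*} [MetricSpace X] [MeasurableSpace X] (μ : Measure X)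
    (ν : Measure ℝ) : Prop :=
  ∀ᵐ t ∂(volume : Measure ℝ), ProbabilityTheory.cdf ν t ∈ measureImage μ →
    ENNReal.ofReal (deriv (ProbabilityTheory.cdf ν) t) ≤
      isoperimetricProfile μ (ProbabilityTheory.cdf ν t)

/-- Essential connectedness: every closed set of measure strictly between `0` and `1` has positive
boundary measure. -/
def IsEssentiallyConnected {X : Type*} [MetricSpace X] [MeasurableSpace X]
    (μ : Measure X) : Prop :=
  ∀ A : Set X, IsClosed A → 0 < μ A → μ A < 1 → 0 < boundaryMeasure μ A

/-- The class `𝒱` of Borel probability measures on `ℝ` that are absolutely continuous with respect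
to Lebesgue measure and have connected support. -/
structure MemClassV (ν : Measure ℝ) : Prop where
  isProbabilityMeasure : IsProbabilityMeasure ν
  absolutelyContinuous : ν ≪ volume
  isConnected_support : IsConnected ν.support

/-- The `lam`-variance of a function `f`: the double integral of `lam(|f x - f x'|)`. -/
def lambdaVar {X : Type*} [MeasurableSpace X] (lam : ℝ≥0 → ℝ≥0) (μ : Measure X)
    (f : X → ℝ) : ℝ≥0∞ :=
  ∫⁻ x', ∫⁻ x, (lam (nndist (f x) (f x')) : ℝ≥0∞) ∂μ ∂μ

/-- The `lam`-variance of a measure on `ℝ`: the double integral of `lam(|x - x'|)`. -/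
def lambdaVarMeasure (lam : ℝ≥0 → ℝ≥0) (ν : Measure ℝ) : ℝ≥0∞ :=
  ∫⁻ x', ∫⁻ x, (lam (nndist x x') : ℝ≥0∞) ∂ν ∂ν

/-- The `lam`-observable variance: the supremum of the `lam`-variance over `1`-Lipschitz
functions. -/
def obsVar {X : Type*} [MetricSpace X] [MeasurableSpace X] (lam : ℝ≥0 → ℝ≥0)
    (μ : Measure X) : ℝ≥0∞ :=
  ⨆ (f : X → ℝ) (_ : LipschitzWith 1 f), lambdaVar lam μ f

/-- There are two points `p`, `q` at distance `diam X` such that every point of `X` lies on a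
minimal geodesic joining `p` and `q`; moreover, `X` is homeomorphic to a suspension if it is
non-branching. -/
def IsCoveredByMaximalGeodesics (X : Type*) [MetricSpace X] : Prop :=
  (∃ p q : X, dist p q = Metric.diam (univ : Set X) ∧
    ∀ x : X, ∃ γ : ℝ → X, IsMinimalGeodesicJoining p q γ ∧
      ∃ t ∈ Icc 0 (dist p q), γ t = x) ∧
  (IsNonBranching X → IsHomeomorphicToSuspension X)

end

/-! Let `f` be 1-Lipschitz, `F` the distribution function of `μ.map f`, `V` that of `ν`, and `[a,
b]` the support of `ν`. The `ε`-neighbourhood of `{f ≤ r}` lies in `{f ≤ r + ε}`, so `IC(ν)` bounds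
`F'` from below by `V'` at the same level. With `G = V⁻¹ ∘ F` this reads `V'(G) ≤ F' = V'(G) G'`,
hence `G' ≥ 1` and `G` expands distances (`sub_le_sub_of_satisfiesIC`). The delicate point is that
`IC(ν)` fails on a null set, whose preimage under `G` must be null: `F` maps that preimage into a
null set because `V` has property (N), while `F' > 0` by essential connectedness.

Expansion of `G` into `[a, b]` bounds the oscillation of `f` by `b - a`; taking for `f` the distance
from an end point of a diameter gives the diameter bound. Dually, the monotone map carrying `ν` to
`μ.map f` is 1-Lipschitz, so variances of `f` are at most those of `ν`, even with distances
truncated at `diam X`. Truncation loses something strictly if `diam X < b - a`.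

If `diam X = b - a = dist p q`, expansion has no slack, and both `dist p ·` and `b - a - dist · q`
have the law of `ν` translated by `-a`. The triangle inequality orders these two functions, so they
coincide, and every point lies metrically between `p` and `q`. Without branching, each point of the
middle level lies on exactly one geodesic from `p` to `q`, and these geodesics form the suspension.
-/

open ProbabilityTheory (cdf)

/-! ### Distribution functions of absolutely continuous measures supported on an interval -/

section CDF

variable {ν : Measure ℝ} [IsProbabilityMeasure ν] {a b : ℝ}

lemma continuous_cdf_of_absolutelyContinuous (hac : ν ≪ volume) : Continuous (cdf ν) := by
  rw [continuous_iff_continuousAt]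
  intro x
  rw [(cdf ν).mono.continuousAt_iff_leftLim_eq_rightLim, StieltjesFunction.rightLim_eq]
  have h0 : (cdf ν).measure {x} = 0 := by
    rw [ProbabilityTheory.measure_cdf]
    exact hac (by simp)
  rw [StieltjesFunction.measure_singleton, ENNReal.ofReal_eq_zero] at h0
  have := (cdf ν).mono.leftLim_le (le_refl x)
  linarith

lemma MemClassV.exists_support_eq_Icc (hν : MemClassV ν) (hνc : IsCompact ν.support) :
    ∃ a b : ℝ, a < b ∧ ν.support = Icc a b := by
  have h := eq_Icc_of_connected_compact hν.isConnected_support hνc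
  refine ⟨_, _, ?_, h⟩
  by_contra hlt
  have h1 : ν.support.Subsingleton := by
    rw [h]
    exact subsingleton_Icc_of_ge (not_lt.1 hlt)
  have h2 : ν ν.support = 0 := hν.absolutelyContinuous (h1.measure_zero _)
  have h3 : ν univ ≤ ν ν.support + ν ν.supportᶜ := by
    rw [← union_compl_self ν.support]
    exact measure_union_le _ _
  simp [h2] at h3

lemma measure_Iic_eq_zero_of_support (hac : ν ≪ volume) (hS : ν.support = Icc a b) :
    ν (Iic a) = 0 := by
  refine measure_mono_null (t := ν.supportᶜ ∪ {a}) ?_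
    (measure_union_null (by simp) (hac (by simp)))
  intro x hx
  rcases eq_or_lt_of_le (show x ≤ a from hx) with h | h
  · right; exact h
  · left; rw [hS]; intro h'; exact absurd h'.1 (not_le.2 h)

lemma measure_Ici_eq_zero_of_support (hac : ν ≪ volume) (hS : ν.support = Icc a b) :
    ν (Ici b) = 0 := by
  refine measure_mono_null (t := ν.supportᶜ ∪ {b}) ?_
    (measure_union_null (by simp) (hac (by simp)))
  intro x hx
  rcases eq_or_lt_of_le (show b ≤ x from hx) with h | h
  · right; exact h.symm
  · left; rw [hS]; intro h'; exact absurd h'.2 (not_le.2 h)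

lemma ae_mem_Ioo_of_support (hac : ν ≪ volume) (hS : ν.support = Icc a b) :
    ∀ᵐ x ∂ν, x ∈ Ioo a b := by
  have h : ν (Iic a ∪ Ici b) = 0 := measure_union_null (measure_Iic_eq_zero_of_support hac hS)
    (measure_Ici_eq_zero_of_support hac hS)
  filter_upwards [measure_eq_zero_iff_ae_notMem.1 h] with x hx
  simpa using hx

lemma cdf_eq_zero_of_support (hac : ν ≪ volume) (hS : ν.support = Icc a b) {x : ℝ}
    (hx : x ≤ a) : cdf ν x = 0 := by
  rw [ProbabilityTheory.cdf_eq_real, measureReal_def,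
    measure_mono_null (Iic_subset_Iic.2 hx) (measure_Iic_eq_zero_of_support hac hS)]
  rfl

lemma cdf_eq_one_of_support (hac : ν ≪ volume) (hS : ν.support = Icc a b) {x : ℝ}
    (hx : b ≤ x) : cdf ν x = 1 := by
  have h : ν (Iic x)ᶜ = 0 := by
    rw [compl_Iic]
    exact measure_mono_null (fun y hy => hx.trans (le_of_lt hy))
      (measure_Ici_eq_zero_of_support hac hS)
  rw [ProbabilityTheory.cdf_eq_real, measureReal_def, (prob_compl_eq_zero_iff measurableSet_Iic).1 h]
  rfl

lemma strictMonoOn_cdf_of_support (hS : ν.support = Icc a b) :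
    StrictMonoOn (cdf ν) (Icc a b) := by
  intro x hx y hy hxy
  obtain ⟨z, hz⟩ := exists_between hxy
  have hzs : z ∈ ν.support := by
    rw [hS]
    exact ⟨hx.1.trans hz.1.le, hz.2.le.trans hy.2⟩
  have hpos : 0 < ν (Ioc x y) := (Measure.mem_support_iff_forall z).1 hzs _ (Ioc_mem_nhds hz.1 hz.2)
  rw [← ProbabilityTheory.measure_cdf ν, StieltjesFunction.measure_Ioc, ENNReal.ofReal_pos] at hpos
  linarith

lemma exists_mem_Icc_cdf_eq (hac : ν ≪ volume) (hab : a < b) (hS : ν.support = Icc a b) {v : ℝ}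
    (hv : v ∈ Icc (0 : ℝ) 1) : ∃ x ∈ Icc a b, cdf ν x = v := by
  have h := intermediate_value_Icc hab.le
    (continuous_cdf_of_absolutelyContinuous hac).continuousOn
  rw [cdf_eq_zero_of_support hac hS le_rfl, cdf_eq_one_of_support hac hS le_rfl] at h
  exact h hv

lemma cdf_le_cdf_iff_of_support (hac : ν ≪ volume) (hS : ν.support = Icc a b) {x y : ℝ}
    (hx : x ∈ Icc a b) (hxb : x < b) : cdf ν y ≤ cdf ν x ↔ y ≤ x := by
  refine ⟨fun h => ?_, fun h => (cdf ν).mono h⟩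
  by_contra hlt
  push Not at hlt
  rcases le_total y b with hyb | hyb
  · exact absurd h (not_le.2 (strictMonoOn_cdf_of_support hS hx ⟨hx.1.trans hlt.le, hyb⟩ hlt))
  · rw [cdf_eq_one_of_support hac hS hyb, ← cdf_eq_one_of_support hac hS le_rfl] at h
    exact absurd h (not_le.2
      (strictMonoOn_cdf_of_support hS hx ⟨hx.1.trans hxb.le, le_rfl⟩ hxb))

/-- The probability integral transform: `V` takes every level in `[0, 1)` at a point `x < b` of the
support, and the sublevel set there is exactly `Iic x`. -/
lemma map_cdf_eq_volume (hac : ν ≪ volume) (hab : a < b) (hS : ν.support = Icc a b) :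
    ν.map (cdf ν) = volume.restrict (Icc 0 1) := by
  have hc := continuous_cdf_of_absolutelyContinuous hac
  refine Measure.ext_of_Iic _ _ fun v => ?_
  rw [Measure.map_apply hc.measurable measurableSet_Iic, Measure.restrict_apply measurableSet_Iic]
  rcases lt_or_ge v 0 with hv | hv
  · have h1 : cdf ν ⁻¹' Iic v = ∅ := by
      ext x
      simpa using hv.trans_le (ProbabilityTheory.cdf_nonneg ν x)
    have h2 : Iic v ∩ Icc (0 : ℝ) 1 = ∅ := by
      ext x
      simp only [mem_inter_iff, mem_Iic, mem_Icc, mem_empty_iff_false, iff_false]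
      intro h
      linarith [h.1, h.2.1]
    rw [h1, h2, measure_empty, measure_empty]
  rcases lt_or_ge v 1 with hv1 | hv1
  · obtain ⟨x, hx, rfl⟩ := exists_mem_Icc_cdf_eq hac hab hS ⟨hv, hv1.le⟩
    have hxb : x < b := by
      refine lt_of_le_of_ne hx.2 fun h => ?_
      rw [cdf_eq_one_of_support hac hS h.ge] at hv1
      exact lt_irrefl _ hv1
    have h1 : cdf ν ⁻¹' Iic (cdf ν x) = Iic x := by
      ext y
      exact cdf_le_cdf_iff_of_support hac hS hx hxb
    have h2 : Iic (cdf ν x) ∩ Icc (0 : ℝ) 1 = Icc 0 (cdf ν x) := by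
      ext y
      simp only [mem_inter_iff, mem_Iic, mem_Icc]
      constructor
      · rintro ⟨h, h', -⟩; exact ⟨h', h⟩
      · rintro ⟨h, h'⟩; exact ⟨h', h, h'.trans hv1.le⟩
    rw [h1, h2, ← ProbabilityTheory.ofReal_cdf, Real.volume_Icc, sub_zero]
  · have h1 : cdf ν ⁻¹' Iic v = univ := by
      ext x
      simpa using (ProbabilityTheory.cdf_le_one ν x).trans hv1
    have h2 : Iic v ∩ Icc (0 : ℝ) 1 = Icc 0 1 :=
      inter_eq_right.2 fun x hx => hx.2.trans hv1
    rw [h1, h2]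
    simp

/-- The distribution function of an absolutely continuous measure has Lusin's property (N). -/
lemma volume_image_cdf_eq_zero (hac : ν ≪ volume) (hab : a < b) (hS : ν.support = Icc a b)
    {N : Set ℝ} (hN : MeasurableSet N) (hN0 : volume N = 0) :
    volume (cdf ν '' (N ∩ Icc a b)) = 0 := by
  have hc := continuous_cdf_of_absolutelyContinuous hac
  have hm : MeasurableSet (cdf ν '' (N ∩ Icc a b)) :=
    (hN.inter measurableSet_Icc).image_of_monotoneOn ((cdf ν).mono.monotoneOn _)
  have hsub : cdf ν '' (N ∩ Icc a b) ⊆ Icc 0 1 := by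
    rintro _ ⟨x, -, rfl⟩
    exact ⟨ProbabilityTheory.cdf_nonneg ν x, ProbabilityTheory.cdf_le_one ν x⟩
  -- The volume of the image is the `ν`-measure of its preimage under `V`, which by injectivity on
  -- `[a, b]` lies in `N` up to a `ν`-null set.
  rw [← Measure.restrict_eq_self volume hsub, ← map_cdf_eq_volume hac hab hS,
    Measure.map_apply hc.measurable hm]
  rw [measure_eq_zero_iff_ae_notMem]
  filter_upwards [ae_mem_Ioo_of_support hac hS, measure_eq_zero_iff_ae_notMem.1 (hac hN0)]
    with x hx hxN
  rintro ⟨y, hy, hyx⟩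
  have := (strictMonoOn_cdf_of_support hS).injOn hy.2 (Ioo_subset_Icc_self hx) hyx
  exact hxN (this ▸ hy.1)

end CDF

/-! ### Expansion from a comparison of derivatives -/

section Expansion

/-- A monotone function whose derivative is at least `1` almost everywhere expands distances. -/
lemma sub_le_sub_of_one_le_deriv {G : ℝ → ℝ} (hG : Monotone G) {s t : ℝ} (hst : s ≤ t)
    (h : ∀ᵐ r, r ∈ Ioo s t → 1 ≤ deriv G r) : t - s ≤ G t - G s := by
  -- For monotone `G` only `∫ G' ≤ G t - G s` is available, but this is the direction needed: jumps
  -- and singular parts only help.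
  have h1 := (hG.monotoneOn (uIcc s t)).intervalIntegral_deriv_mem_uIcc
  rw [uIcc_of_le (by linarith [hG hst])] at h1
  refine le_trans ?_ h1.2
  have h2 : ∫ _ in s..t, (1 : ℝ) = t - s := by simp
  rw [← h2]
  refine intervalIntegral.integral_mono_ae_restrict hst (by simp)
    (hG.monotoneOn (uIcc s t)).intervalIntegrable_deriv ?_
  rw [Filter.EventuallyLE, ← restrict_Ioo_eq_restrict_Icc, ae_restrict_iff' measurableSet_Ioo]
  exact h

variable {ν : Measure ℝ} [IsProbabilityMeasure ν] {a b : ℝ}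

/-- Comparison of a distribution function `F` with the distribution function of `ν`: if `F` grows
at least as fast as `cdf ν` at the same level, then `(cdf ν)⁻¹ ∘ F` expands distances. -/
lemma sub_le_sub_of_le_deriv (hac : ν ≪ volume) (hab : a < b) (hS : ν.support = Icc a b)
    {F G : ℝ → ℝ} (hF : Monotone F) (hG : Monotone G) (hGm : ∀ t, G t ∈ Icc a b)
    (hFG : ∀ t, cdf ν (G t) = F t) {s t : ℝ} (hst : s ≤ t)
    (hpos : ∀ r ∈ Ioo s t, DifferentiableAt ℝ F r → 0 < deriv F r)
    {N : Set ℝ} (hN : volume N = 0)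
    (hle : ∀ r ∈ Ioo s t, G r ∉ N → DifferentiableAt ℝ F r →
      deriv (cdf ν) (G r) ≤ deriv F r) :
    t - s ≤ G t - G s := by
  refine sub_le_sub_of_one_le_deriv hG hst ?_
  set N₁ : Set ℝ := N ∪ {x | ¬ DifferentiableAt ℝ (cdf ν) x} with hN₁def
  have hN₁ : volume N₁ = 0 := measure_union_null hN (cdf ν).mono.ae_differentiableAt
  set N' := toMeasurable volume N₁
  have hN'0 : volume N' = 0 := by rw [measure_toMeasurable, hN₁]
  have hN'm : MeasurableSet N' := measurableSet_toMeasurable _ _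
  set A : Set ℝ := (Ioo s t ∩ {r | DifferentiableAt ℝ F r}) ∩ G ⁻¹' N' with hA
  have hAm : MeasurableSet A := (measurableSet_Ioo.inter (measurableSet_of_differentiableAt ℝ F)).inter
    (hG.measurable hN'm)
  have hA0 : volume A = 0 := by
    -- Change of variables: `∫_A F'` is the volume of `F '' A`, a subset of the `V`-image of a null
    -- set. As `F' > 0` on `A`, the set `A` is null.
    have h1 := lintegral_deriv_eq_volume_image_of_monotoneOn (f := F) (f' := deriv F) hAm
      (fun x hx => hx.1.2.hasDerivAt.hasDerivWithinAt) (hF.monotoneOn A)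
    have h2 : volume (F '' A) = 0 := by
      refine measure_mono_null ?_ (volume_image_cdf_eq_zero hac hab hS hN'm hN'0)
      rintro _ ⟨r, hr, rfl⟩
      exact ⟨G r, ⟨hr.2, hGm r⟩, hFG r⟩
    rw [h2, lintegral_eq_zero_iff (measurable_deriv F).ennreal_ofReal] at h1
    have h3 := (ae_restrict_iff' hAm).1 h1
    rw [measure_eq_zero_iff_ae_notMem]
    filter_upwards [h3] with r hr hrA
    have h4 := hr hrA
    simp only [Pi.zero_apply, ENNReal.ofReal_eq_zero] at h4
    exact absurd (hpos r hrA.1.1 hrA.1.2) (not_lt.2 h4)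
  filter_upwards [hF.ae_differentiableAt, hG.ae_differentiableAt,
    measure_eq_zero_iff_ae_notMem.1 hA0] with r hFr hGr hrA hr
  have hGN : G r ∉ N₁ := fun h => hrA ⟨⟨hr, hFr⟩, subset_toMeasurable _ _ h⟩
  simp only [hN₁def, mem_union, mem_ofPred_eq, not_or, not_not] at hGN
  have hchain : deriv F r = deriv (cdf ν) (G r) * deriv G r := by
    have h5 : F = cdf ν ∘ G := funext fun x => (hFG x).symm
    rw [h5, deriv_comp r hGN.2 hGr]
  have hp := hpos r hr hFr
  have hl := hle r hr hGN.1 hFr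
  have hV : 0 ≤ deriv (cdf ν) (G r) := (cdf ν).mono.deriv_nonneg
  rw [hchain] at hp hl
  have hV' : 0 < deriv (cdf ν) (G r) := lt_of_le_of_ne hV fun h => by
    rw [← h, zero_mul] at hp
    exact lt_irrefl _ hp
  by_contra hlt
  push Not at hlt
  nlinarith

end Expansion

/-! ### Sublevel sets of Lipschitz functions and the isoperimetric comparison -/

section Sublevel

variable {X : Type*} [MetricSpace X] [MeasurableSpace X] [BorelSpace X] {μ : Measure X}
  [IsProbabilityMeasure μ] {f : X → ℝ}

lemma cdf_map_eq_real {α : Type*} [MeasurableSpace α] {ρ : Measure α} [IsProbabilityMeasure ρ]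
    {g : α → ℝ} (hf : Measurable g) (t : ℝ) : cdf (ρ.map g) t = ρ.real {x | g x ≤ t} := by
  have := Measure.isProbabilityMeasure_map (μ := ρ) hf.aemeasurable
  rw [ProbabilityTheory.cdf_eq_real, map_measureReal_apply hf measurableSet_Iic]
  rfl

/-- A 1-Lipschitz function grows by at most `ε` on an `ε`-neighbourhood, so the quotients defining
the boundary measure are bounded by difference quotients of the distribution function. -/
lemma boundaryMeasure_sublevel_le (hf : LipschitzWith 1 f) {r : ℝ}
    (hd : DifferentiableAt ℝ (cdf (μ.map f)) r) :
    boundaryMeasure μ {x | f x ≤ r} ≤ ENNReal.ofReal (deriv (cdf (μ.map f)) r) := by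
  have hfm : Measurable f := hf.continuous.measurable
  have hlim : Tendsto (fun ε : ℝ => ENNReal.ofReal (ε⁻¹ *
      (cdf (μ.map f) (r + ε) - cdf (μ.map f) r))) (𝓝[>] 0)
      (𝓝 (ENNReal.ofReal (deriv (cdf (μ.map f)) r))) := by
    refine (ENNReal.continuous_ofReal.tendsto _).comp ?_
    simpa using hd.hasDerivAt.tendsto_slope_zero_right
  rw [← hlim.limsup_eq]
  refine limsup_le_limsup ?_
  filter_upwards [self_mem_nhdsWithin] with ε hε
  have hε' : 0 < ε := hε
  rw [ENNReal.ofReal_mul (by positivity), mul_comm, ENNReal.ofReal_inv_of_pos hε',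
    ← div_eq_mul_inv]
  refine ENNReal.div_le_div_right ?_ _
  rw [cdf_map_eq_real hfm, cdf_map_eq_real hfm, ENNReal.ofReal_sub _ measureReal_nonneg,
    ofReal_measureReal, ofReal_measureReal]
  refine tsub_le_tsub_right (measure_mono ?_) _
  intro x hx
  obtain ⟨z, hz, hxz⟩ := Metric.mem_thickening_iff.1 hx
  have h1 := hf.dist_le_mul x z
  rw [Real.dist_eq, NNReal.coe_one, one_mul] at h1
  have h2 := (abs_le.1 (h1.trans hxz.le)).2
  simp only [mem_ofPred_eq] at hz ⊢
  linarith

variable {ν : Measure ℝ} [IsProbabilityMeasure ν] {a b : ℝ}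

/-- Sublevel sets of `f` serve as test sets: essential connectedness makes `F'` positive strictly
between the levels `0` and `1`, and `IC(ν)` gives `V'(G) ≤ F'` off its exceptional null set. -/
lemma sub_le_sub_of_satisfiesIC (hconn : IsEssentiallyConnected μ) (hac : ν ≪ volume)
    (hab : a < b) (hS : ν.support = Icc a b) (hIC : SatisfiesIC μ ν) (hf : LipschitzWith 1 f)
    {G : ℝ → ℝ} (hGm : ∀ t, G t ∈ Icc a b) (hFG : ∀ t, cdf ν (G t) = cdf (μ.map f) t)
    {s t : ℝ} (hst : s ≤ t) (h0 : 0 < cdf (μ.map f) s) (h1 : cdf (μ.map f) t < 1) :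
    t - s ≤ G t - G s := by
  have hfm : Measurable f := hf.continuous.measurable
  have hG : Monotone G := fun x y hxy =>
    ((strictMonoOn_cdf_of_support hS).le_iff_le (hGm x) (hGm y)).1 (by
      rw [hFG, hFG]; exact (cdf (μ.map f)).mono hxy)
  refine sub_le_sub_of_le_deriv hac hab hS (cdf (μ.map f)).mono hG hGm hFG hst ?_
    (N := {x | ¬ (cdf ν x ∈ measureImage μ → ENNReal.ofReal (deriv (cdf ν) x) ≤
      isoperimetricProfile μ (cdf ν x))}) hIC ?_
  · intro r hr hd
    have hb := boundaryMeasure_sublevel_le hf hd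
    have hr0 : 0 < cdf (μ.map f) r := h0.trans_le ((cdf (μ.map f)).mono hr.1.le)
    have hr1 : cdf (μ.map f) r < 1 := ((cdf (μ.map f)).mono hr.2.le).trans_lt h1
    rw [cdf_map_eq_real hfm] at hr0 hr1
    have hpos := hconn {x | f x ≤ r} (isClosed_le hf.continuous continuous_const)
      (by
        rw [pos_iff_ne_zero]
        intro h
        rw [measureReal_def, h] at hr0
        exact lt_irrefl _ hr0)
      (by
        refine lt_of_le_of_ne prob_le_one fun h => ?_
        rw [measureReal_def, h] at hr1
        exact lt_irrefl _ hr1)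
    exact ENNReal.ofReal_pos.1 (hpos.trans_le hb)
  · intro r hr hrN hd
    simp only [mem_ofPred_eq, not_not] at hrN
    have hmeas : MeasurableSet {x | f x ≤ r} :=
      (isClosed_le hf.continuous continuous_const).measurableSet
    have heq : μ.real {x | f x ≤ r} = cdf ν (G r) := by rw [hFG, cdf_map_eq_real hfm]
    have h2 := hrN ⟨_, hmeas, heq⟩
    have h3 : isoperimetricProfile μ (cdf ν (G r)) ≤ boundaryMeasure μ {x | f x ≤ r} :=
      iInf_le_of_le _ (iInf_le_of_le hmeas (iInf_le_of_le heq le_rfl))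
    have h4 := (h2.trans h3).trans (boundaryMeasure_sublevel_le hf hd)
    exact (ENNReal.ofReal_le_ofReal_iff (cdf (μ.map f)).mono.deriv_nonneg).1 h4

end Sublevel

/-! ### Monotone transport on the line -/

section Transport

/-- The monotone map transporting `ν` to `ρ` (for `ν` without atoms). -/
noncomputable def monotoneTransport (ν ρ : Measure ℝ) (x : ℝ) : ℝ :=
  sInf {t | cdf ν x ≤ cdf ρ t}

/-- The Galois property of the quantile function: right continuity of `cdf ρ` makes the infimum
attained. -/
lemma sInf_le_iff_le_cdf (ρ : Measure ℝ) {v t : ℝ} (h0 : 0 < v) (h1 : v < 1) :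
    sInf {t | v ≤ cdf ρ t} ≤ t ↔ v ≤ cdf ρ t := by
  have hne : {t | v ≤ cdf ρ t}.Nonempty :=
    (((ProbabilityTheory.tendsto_cdf_atTop ρ).eventually_const_lt h1).mono
      fun _ h => le_of_lt h).exists
  have hbdd : BddBelow {t | v ≤ cdf ρ t} := by
    obtain ⟨c, hc⟩ := ((ProbabilityTheory.tendsto_cdf_atBot ρ).eventually_lt_const h0).exists
    refine ⟨c, fun t ht => ?_⟩
    by_contra hlt
    exact absurd ((ht.trans ((cdf ρ).mono (le_of_not_ge hlt))).trans_lt hc) (lt_irrefl _)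
  refine ⟨fun h => ?_, fun h => csInf_le hbdd h⟩
  refine le_trans ?_ ((cdf ρ).mono h)
  set c := sInf {t | v ≤ cdf ρ t}
  have hlim : Tendsto (cdf ρ) (𝓝[>] c) (𝓝 (cdf ρ c)) :=
    ((cdf ρ).right_continuous c).mono_left (nhdsWithin_mono _ Ioi_subset_Ici_self)
  refine ge_of_tendsto hlim ?_
  filter_upwards [self_mem_nhdsWithin] with t ht
  obtain ⟨u, hu, hut⟩ := exists_lt_of_csInf_lt hne ht
  exact le_trans hu ((cdf ρ).mono hut.le)

variable {ν : Measure ℝ} [IsProbabilityMeasure ν] {a b : ℝ}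

lemma cdf_mem_Ioo_of_support (hac : ν ≪ volume) (hS : ν.support = Icc a b) {x : ℝ}
    (hx : x ∈ Ioo a b) : 0 < cdf ν x ∧ cdf ν x < 1 := by
  have hab := (hx.1.trans hx.2).le
  have h := strictMonoOn_cdf_of_support hS
  constructor
  · rw [← cdf_eq_zero_of_support hac hS le_rfl]
    exact h ⟨le_rfl, hab⟩ (Ioo_subset_Icc_self hx) hx.1
  · rw [← cdf_eq_one_of_support hac hS le_rfl]
    exact h (Ioo_subset_Icc_self hx) ⟨hab, le_rfl⟩ hx.2

lemma monotoneTransport_le_iff (hac : ν ≪ volume) (hS : ν.support = Icc a b) (ρ : Measure ℝ)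
    {x t : ℝ} (hx : x ∈ Ioo a b) : monotoneTransport ν ρ x ≤ t ↔ cdf ν x ≤ cdf ρ t :=
  sInf_le_iff_le_cdf ρ (cdf_mem_Ioo_of_support hac hS hx).1 (cdf_mem_Ioo_of_support hac hS hx).2

lemma monotoneOn_monotoneTransport (hac : ν ≪ volume) (hS : ν.support = Icc a b)
    (ρ : Measure ℝ) : MonotoneOn (monotoneTransport ν ρ) (Ioo a b) := fun x hx y hy hxy => by
  rw [monotoneTransport_le_iff hac hS ρ hx]
  exact ((cdf ν).mono hxy).trans ((monotoneTransport_le_iff hac hS ρ hy).1 le_rfl)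

lemma aemeasurable_monotoneTransport (hac : ν ≪ volume) (hS : ν.support = Icc a b)
    (ρ : Measure ℝ) : AEMeasurable (monotoneTransport ν ρ) ν := by
  have h := aemeasurable_restrict_of_monotoneOn (μ := ν) measurableSet_Ioo
    (monotoneOn_monotoneTransport hac hS ρ)
  rwa [Measure.restrict_eq_self_of_ae_mem (ae_mem_Ioo_of_support hac hS)] at h

lemma map_monotoneTransport (hac : ν ≪ volume) (hab : a < b) (hS : ν.support = Icc a b)
    (ρ : Measure ℝ) [IsProbabilityMeasure ρ] : ν.map (monotoneTransport ν ρ) = ρ := by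
  have hm := aemeasurable_monotoneTransport hac hS ρ
  have := Measure.isProbabilityMeasure_map (μ := ν) hm
  refine Measure.ext_of_Iic _ _ fun t => ?_
  -- `g` is the point of `[a, b]` at the level `cdf ρ t`; the Galois property then turns the
  -- preimage of `Iic t` into `Iic g`, up to a null set.
  obtain ⟨g, hg, hgt⟩ := exists_mem_Icc_cdf_eq hac hab hS
    ⟨ProbabilityTheory.cdf_nonneg ρ t, ProbabilityTheory.cdf_le_one ρ t⟩
  rw [Measure.map_apply_of_aemeasurable hm measurableSet_Iic, ← ProbabilityTheory.ofReal_cdf ρ,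
    ← hgt, ProbabilityTheory.ofReal_cdf]
  refine measure_congr ?_
  filter_upwards [ae_mem_Ioo_of_support hac hS] with x hx
  refine propext ?_
  change monotoneTransport ν ρ x ≤ t ↔ x ≤ g
  rw [monotoneTransport_le_iff hac hS ρ hx, ← hgt]
  exact (strictMonoOn_cdf_of_support hS).le_iff_le (Ioo_subset_Icc_self hx) hg

end Transport

/-! ### The transport map is 1-Lipschitz -/

section Domination

variable {X : Type*} [MetricSpace X] [MeasurableSpace X] [BorelSpace X] {μ : Measure X}
  [IsProbabilityMeasure μ] {f : X → ℝ} {ν : Measure ℝ} [IsProbabilityMeasure ν] {a b : ℝ}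

lemma exists_cdf_lift (hac : ν ≪ volume) (hab : a < b) (hS : ν.support = Icc a b)
    (ρ : Measure ℝ) : ∃ G : ℝ → ℝ, (∀ t, G t ∈ Icc a b) ∧ ∀ t, cdf ν (G t) = cdf ρ t := by
  choose G h1 h2 using fun t => exists_mem_Icc_cdf_eq hac hab hS
    ⟨ProbabilityTheory.cdf_nonneg ρ t, ProbabilityTheory.cdf_le_one ρ t⟩
  exact ⟨G, h1, h2⟩

lemma monotoneTransport_sub_le (hconn : IsEssentiallyConnected μ) (hac : ν ≪ volume)
    (hS : ν.support = Icc a b) (hIC : SatisfiesIC μ ν) (hf : LipschitzWith 1 f)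
    {x y : ℝ} (hx : x ∈ Ioo a b) (hy : y ∈ Ioo a b) (hxy : x ≤ y) :
    monotoneTransport ν (μ.map f) y - monotoneTransport ν (μ.map f) x ≤ y - x := by
  have hab := hx.1.trans hx.2
  obtain ⟨G, hGm, hFG⟩ := exists_cdf_lift hac hab hS (μ.map f)
  by_contra hlt
  push Not at hlt
  -- Stopping just below the transport of `y` keeps the level at `t` below `V y < 1`, even if there
  -- is an atom, while `t - s` still exceeds `y - x`. Expansion then contradicts `x ≤ G s` and `G t
  -- < y`.
  obtain ⟨t, ht1, ht2⟩ := exists_between (lt_sub_iff_add_lt.1 hlt)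
  set s := monotoneTransport ν (μ.map f) x with hs
  have h1 : cdf ν x ≤ cdf (μ.map f) s := (monotoneTransport_le_iff hac hS _ hx).1 le_rfl
  have h2 : cdf (μ.map f) t < cdf ν y :=
    not_le.1 fun h => absurd ((monotoneTransport_le_iff hac hS _ hy).2 h) (not_le.2 ht2)
  have h3 := sub_le_sub_of_satisfiesIC hconn hac hab hS hIC hf hGm hFG (s := s) (t := t)
    (by linarith) ((cdf_mem_Ioo_of_support hac hS hx).1.trans_le h1)
    (h2.trans (cdf_mem_Ioo_of_support hac hS hy).2)
  rw [← hFG] at h1 h2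
  have h4 := ((strictMonoOn_cdf_of_support hS).le_iff_le (Ioo_subset_Icc_self hx) (hGm s)).1 h1
  have h5 := ((strictMonoOn_cdf_of_support hS).lt_iff_lt (hGm t) (Ioo_subset_Icc_self hy)).1 h2
  linarith

lemma nndist_monotoneTransport_le (hconn : IsEssentiallyConnected μ) (hac : ν ≪ volume)
    (hS : ν.support = Icc a b) (hIC : SatisfiesIC μ ν) (hf : LipschitzWith 1 f)
    {x y : ℝ} (hx : x ∈ Ioo a b) (hy : y ∈ Ioo a b) :
    nndist (monotoneTransport ν (μ.map f) x) (monotoneTransport ν (μ.map f) y) ≤ nndist x y := by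
  rw [← NNReal.coe_le_coe, coe_nndist, coe_nndist]
  wlog hxy : x ≤ y generalizing x y
  · rw [dist_comm, dist_comm x y]
    exact this hy hx (le_of_not_ge hxy)
  have h1 := monotoneTransport_sub_le hconn hac hS hIC hf hx hy hxy
  have h2 := monotoneOn_monotoneTransport hac hS (μ.map f) hx hy hxy
  rw [dist_comm, dist_comm x y, Real.dist_eq, Real.dist_eq, abs_of_nonneg (sub_nonneg.2 h2),
    abs_of_nonneg (sub_nonneg.2 hxy)]
  exact h1

lemma monotoneTransport_mem_Icc {α : Type*} [MeasurableSpace α] {ρ : Measure α}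
    [IsProbabilityMeasure ρ] {g : α → ℝ} (hac : ν ≪ volume) (hS : ν.support = Icc a b)
    (hf : Measurable g) {m M : ℝ} (hfm : ∀ x, g x ∈ Icc m M) {x : ℝ} (hx : x ∈ Ioo a b) :
    monotoneTransport ν (ρ.map g) x ∈ Icc m M := by
  have hV := cdf_mem_Ioo_of_support hac hS hx
  constructor
  · by_contra hlt
    have h := (monotoneTransport_le_iff hac hS (ρ.map g) hx).1 le_rfl
    rw [cdf_map_eq_real hf] at h
    have h0 : {z | g z ≤ monotoneTransport ν (ρ.map g) x} = ∅ := by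
      ext z
      simp only [mem_ofPred_eq, mem_empty_iff_false, iff_false, not_le]
      exact (not_le.1 hlt).trans_le (hfm z).1
    rw [h0, measureReal_empty] at h
    linarith
  · rw [monotoneTransport_le_iff hac hS _ hx, cdf_map_eq_real hf]
    have h1 : {z | g z ≤ M} = univ := eq_univ_of_forall fun z => (hfm z).2
    rw [h1, probReal_univ]
    exact hV.2.le

lemma nndist_monotoneTransport_le_of_mem_Icc {α : Type*} [MeasurableSpace α]
    {ρ : Measure α} [IsProbabilityMeasure ρ] {g : α → ℝ} (hac : ν ≪ volume)
    (hS : ν.support = Icc a b) (hg : Measurable g) {m : ℝ} {D : ℝ≥0} (hgm : ∀ x, g x ∈ Icc m (m + D)) {x y : ℝ}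
    (hx : x ∈ Ioo a b) (hy : y ∈ Ioo a b) :
    nndist (monotoneTransport ν (ρ.map g) x) (monotoneTransport ν (ρ.map g) y) ≤ D := by
  rw [← NNReal.coe_le_coe, coe_nndist]
  refine (Real.dist_le_of_mem_Icc (monotoneTransport_mem_Icc hac hS hg hgm hx)
    (monotoneTransport_mem_Icc hac hS hg hgm hy)).trans_eq ?_
  ring

end Domination

/-! ### Comparison of variances -/

section Variance

variable {X : Type*} [MetricSpace X] [MeasurableSpace X] [BorelSpace X] {μ : Measure X}
  [IsProbabilityMeasure μ] {f : X → ℝ} {ν : Measure ℝ} [IsProbabilityMeasure ν] {a b : ℝ}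
  {lam : ℝ≥0 → ℝ≥0}

lemma lambdaVarMeasure_map {α : Type*} [MeasurableSpace α] {ρ : Measure α} [SFinite ρ]
    (hlam : Continuous lam) {g : α → ℝ} (hg : AEMeasurable g ρ) :
    lambdaVarMeasure lam (ρ.map g) = lambdaVar lam ρ g := by
  have hk : Measurable fun p : ℝ × ℝ => (lam (nndist p.2 p.1) : ℝ≥0∞) := by
    refine Continuous.measurable ?_
    fun_prop
  rw [lambdaVarMeasure, lambdaVar, lintegral_map' hk.lintegral_prod_right'.aemeasurable hg]
  refine lintegral_congr fun x' => ?_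
  exact lintegral_map' (hk.comp (measurable_prodMk_left (x := g x'))).aemeasurable hg

/-- Pulled back to `ν` by the transport map, distances of values of `f` are at most `nndist x x'` by
contraction and at most `D` by the range of `f`. -/
lemma lambdaVar_le_of_satisfiesIC (hconn : IsEssentiallyConnected μ) (hac : ν ≪ volume)
    (hab : a < b) (hS : ν.support = Icc a b) (hIC : SatisfiesIC μ ν) (hf : LipschitzWith 1 f)
    (hlam : Continuous lam) (hmono : Monotone lam) {m : ℝ} {D : ℝ≥0}
    (hfm : ∀ x, f x ∈ Icc m (m + D)) :
    lambdaVar lam μ f ≤ ∫⁻ x', ∫⁻ x, (lam (min (nndist x x') D) : ℝ≥0∞) ∂ν ∂ν := by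
  have hfmeas := hf.continuous.measurable
  have := Measure.isProbabilityMeasure_map (μ := μ) hfmeas.aemeasurable
  rw [← lambdaVarMeasure_map hlam hfmeas.aemeasurable, ← map_monotoneTransport hac hab hS (μ.map f),
    lambdaVarMeasure_map hlam (aemeasurable_monotoneTransport hac hS _)]
  have hae := ae_mem_Ioo_of_support hac hS
  refine lintegral_mono_ae ?_
  filter_upwards [hae] with y hy
  refine lintegral_mono_ae ?_
  filter_upwards [hae] with x hx
  exact ENNReal.coe_le_coe.2 (hmono (le_min (nndist_monotoneTransport_le hconn hac hS hIC hf hx hy)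
    (nndist_monotoneTransport_le_of_mem_Icc hac hS hfmeas hfm hx hy)))

/-- Since `a` and `b` belong to the support, pairs near `(a, b)` have positive product measure, and
there the truncation at `D` is effective. -/
lemma lintegral_min_lt_lambdaVarMeasure (hab : a < b) (hS : ν.support = Icc a b)
    (hlam : Continuous lam) (hmono : StrictMono lam) {D : ℝ≥0} (hD : (D : ℝ) < b - a) :
    ∫⁻ x', ∫⁻ x, (lam (min (nndist x x') D) : ℝ≥0∞) ∂ν ∂ν < lambdaVarMeasure lam ν := by
  have hk1 : Measurable fun p : ℝ × ℝ => (lam (min (nndist p.2 p.1) D) : ℝ≥0∞) :=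
    Continuous.measurable (by fun_prop)
  have hk2 : Measurable fun p : ℝ × ℝ => (lam (nndist p.2 p.1) : ℝ≥0∞) :=
    Continuous.measurable (by fun_prop)
  have e1 := lintegral_prod (μ := ν) (ν := ν) _ hk1.aemeasurable
  have e2 := lintegral_prod (μ := ν) (ν := ν) _ hk2.aemeasurable
  rw [lambdaVarMeasure]
  change ∫⁻ x', ∫⁻ x, (fun p : ℝ × ℝ => (lam (min (nndist p.2 p.1) D) : ℝ≥0∞)) (x', x) ∂ν ∂ν <
    ∫⁻ x', ∫⁻ x, (fun p : ℝ × ℝ => (lam (nndist p.2 p.1) : ℝ≥0∞)) (x', x) ∂ν ∂ν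
  rw [← e1, ← e2]
  set U : Set (ℝ × ℝ) := {p | D < nndist p.2 p.1} with hU
  have hUo : IsOpen U := isOpen_lt continuous_const (by fun_prop)
  have hUpos : (ν.prod ν) U ≠ 0 := by
    have hmem : (a, b) ∈ U := by
      rw [hU, mem_ofPred_eq, ← NNReal.coe_lt_coe, coe_nndist, Real.dist_eq,
        abs_of_pos (sub_pos.2 hab)]
      exact hD
    obtain ⟨u, hu, v, hv, huv⟩ := mem_nhds_prod_iff.1 (hUo.mem_nhds hmem)
    have h1 : 0 < ν u := (Measure.mem_support_iff_forall a).1 (hS ▸ ⟨le_rfl, hab.le⟩) u hu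
    have h2 : 0 < ν v := (Measure.mem_support_iff_forall b).1 (hS ▸ ⟨hab.le, le_rfl⟩) v hv
    have h3 : (ν.prod ν) (u ×ˢ v) ≤ (ν.prod ν) U := measure_mono huv
    rw [Measure.prod_prod] at h3
    exact ((ENNReal.mul_pos h1.ne' h2.ne').trans_le h3).ne'
  refine lintegral_strict_mono_of_ae_le_of_ae_lt_on hk2.aemeasurable ?_ ?_ hUpos ?_
  · refine ne_top_of_le_ne_top (b := (lam D : ℝ≥0∞)) ENNReal.coe_ne_top ?_
    calc _ ≤ ∫⁻ _, (lam D : ℝ≥0∞) ∂(ν.prod ν) :=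
          lintegral_mono fun p => ENNReal.coe_le_coe.2 (hmono.monotone (min_le_right _ _))
      _ = lam D := by simp
  · exact Eventually.of_forall fun p => ENNReal.coe_le_coe.2 (hmono.monotone (min_le_left _ _))
  · refine Eventually.of_forall fun p hp => ENNReal.coe_lt_coe.2 (hmono ?_)
    rw [min_eq_right (le_of_lt hp)]
    exact hp

end Variance

/-! ### Maximal oscillation and rigidity -/

section Rigidity

variable {X : Type*} [MetricSpace X] [MeasurableSpace X] [BorelSpace X] {μ : Measure X}
  [IsProbabilityMeasure μ] {f : X → ℝ} {ν : Measure ℝ} [IsProbabilityMeasure ν] {a b D : ℝ}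

lemma cdf_map_pos_of_lt (hsupp : μ.support = univ) (hf : Continuous f) {p : X} {t : ℝ}
    (ht : f p < t) : 0 < cdf (μ.map f) t := by
  rw [cdf_map_eq_real hf.measurable]
  have h1 : 0 < μ {x | f x ≤ t} := (Measure.mem_support_iff_forall p).1 (hsupp ▸ mem_univ p) _
    (mem_of_superset ((isOpen_lt hf continuous_const).mem_nhds ht) fun x (hx : f x < t) => hx.le)
  exact ENNReal.toReal_pos h1.ne' (measure_ne_top _ _)

lemma cdf_map_lt_one_of_lt (hsupp : μ.support = univ) (hf : Continuous f) {q : X} {t : ℝ}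
    (ht : t < f q) : cdf (μ.map f) t < 1 := by
  rw [cdf_map_eq_real hf.measurable]
  have ho : IsOpen {x | t < f x} := isOpen_lt continuous_const hf
  have h1 : 0 < μ {x | t < f x} := (Measure.mem_support_iff_forall q).1 (hsupp ▸ mem_univ q) _
    (ho.mem_nhds ht)
  have h2 : {x | f x ≤ t} = {x | t < f x}ᶜ := by ext x; simp
  rw [h2, probReal_compl_eq_one_sub ho.measurableSet]
  have h3 : 0 < μ.real {x | t < f x} := ENNReal.toReal_pos h1.ne' (measure_ne_top _ _)
  linarith

/-- The oscillation of a `1`-Lipschitz function is at most the length of the support of `ν`. -/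
lemma sub_le_of_satisfiesIC (hsupp : μ.support = univ) (hconn : IsEssentiallyConnected μ)
    (hac : ν ≪ volume) (hab : a < b) (hS : ν.support = Icc a b) (hIC : SatisfiesIC μ ν)
    (hf : LipschitzWith 1 f) (p q : X) : f q - f p ≤ b - a := by
  obtain ⟨G, hGm, hFG⟩ := exists_cdf_lift hac hab hS (μ.map f)
  by_contra hlt
  push Not at hlt
  obtain ⟨c, hc1, hc2⟩ := exists_between hlt
  -- Both ends are moved inwards by half the excess over `c`, so that the levels are strictly
  -- between `0` and `1` and the length is `c > b - a`.
  have h := sub_le_sub_of_satisfiesIC hconn hac hab hS hIC hf hGm hFG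
    (s := f p + (f q - f p - c) / 2) (t := f q - (f q - f p - c) / 2) (by linarith)
    (cdf_map_pos_of_lt hsupp hf.continuous (p := p) (by linarith))
    (cdf_map_lt_one_of_lt hsupp hf.continuous (q := q) (by linarith))
  linarith [(hGm (f p + (f q - f p - c) / 2)).1, (hGm (f q - (f q - f p - c) / 2)).2]

/-- A `1`-Lipschitz function with maximal oscillation is distributed like a translate of `ν`. -/
lemma map_eq_map_sub_of_satisfiesIC (hsupp : μ.support = univ) (hconn : IsEssentiallyConnected μ)
    (hac : ν ≪ volume) (hab : a < b) (hS : ν.support = Icc a b) (hIC : SatisfiesIC μ ν)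
    (hf : LipschitzWith 1 f) (hfm : ∀ x, f x ∈ Icc 0 (b - a)) {p q : X} (hp : f p = 0)
    (hq : f q = b - a) : μ.map f = ν.map (fun x => x - a) := by
  have hfmeas := hf.continuous.measurable
  have hm : Measurable fun x : ℝ => x - a := by fun_prop
  have := Measure.isProbabilityMeasure_map (μ := μ) hfmeas.aemeasurable
  have := Measure.isProbabilityMeasure_map (μ := ν) hm.aemeasurable
  obtain ⟨G, hGm, hFG⟩ := exists_cdf_lift hac hab hS (μ.map f)
  have hmain : ∀ t ∈ Ioo 0 (b - a), cdf (μ.map f) t = cdf ν (a + t) := by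
    intro t ht
    have hexp : ∀ s u, 0 < s → s ≤ u → u < b - a → u - s ≤ G u - G s := fun s u h1 h2 h3 =>
      sub_le_sub_of_satisfiesIC hconn hac hab hS hIC hf hGm hFG h2
        (cdf_map_pos_of_lt hsupp hf.continuous (p := p) (by rwa [hp]))
        (cdf_map_lt_one_of_lt hsupp hf.continuous (q := q) (by rwa [hq]))
    rw [← hFG]
    congr 1
    -- Expansion from `t` to points near `b - a` gives `G t ≤ a + t`, and from points near `0` to
    -- `t` gives `G t ≥ a + t`.
    refine le_antisymm (le_of_forall_pos_lt_add fun ε hε => ?_)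
      (le_of_forall_pos_lt_add fun ε hε => ?_)
    · have h1 : t < b - a - min (ε / 2) ((b - a - t) / 2) := by
        linarith [min_le_right (ε / 2) ((b - a - t) / 2), ht.2]
      have h2 : 0 < min (ε / 2) ((b - a - t) / 2) :=
        lt_min (half_pos hε) (half_pos (sub_pos.2 ht.2))
      have h3 := hexp t _ ht.1 h1.le (by linarith)
      linarith [(hGm (b - a - min (ε / 2) ((b - a - t) / 2))).2,
        min_le_left (ε / 2) ((b - a - t) / 2)]
    · have h2 : 0 < min (ε / 2) (t / 2) := lt_min (half_pos hε) (half_pos ht.1)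
      have h3 := hexp (min (ε / 2) (t / 2)) t h2
        (by linarith [min_le_right (ε / 2) (t / 2), ht.1]) ht.2
      linarith [(hGm (min (ε / 2) (t / 2))).1, min_le_left (ε / 2) (t / 2)]
  refine Measure.eq_of_cdf _ _ (StieltjesFunction.ext fun t => ?_)
  have hright : cdf (ν.map fun x => x - a) t = cdf ν (a + t) := by
    rw [cdf_map_eq_real hm, ProbabilityTheory.cdf_eq_real]
    congr 1
    ext x
    simp [add_comm]
  rw [hright]
  rcases lt_or_ge t (b - a) with htb | htb
  · rcases lt_trichotomy t 0 with ht | ht | ht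
    · rw [cdf_eq_zero_of_support hac hS (by linarith), cdf_map_eq_real hfmeas]
      have h0 : {x | f x ≤ t} = ∅ := by
        ext x
        simpa using ht.trans_le (hfm x).1
      rw [h0, measureReal_empty]
    · subst ht
      -- Right continuity excludes an atom at `0`, which the identity on the open interval does not
      -- see.
      have h1 : Tendsto (cdf (μ.map f)) (𝓝[>] 0) (𝓝 (cdf (μ.map f) 0)) :=
        ((cdf (μ.map f)).right_continuous 0).mono_left (nhdsWithin_mono _ Ioi_subset_Ici_self)
      have h2 : Tendsto (fun t => cdf ν (a + t)) (𝓝[>] 0) (𝓝 (cdf ν (a + 0))) :=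
        (((continuous_cdf_of_absolutelyContinuous hac).comp
          (continuous_const.add continuous_id)).tendsto 0).mono_left nhdsWithin_le_nhds
      refine tendsto_nhds_unique (h1.congr' ?_) h2
      filter_upwards [Ioo_mem_nhdsGT htb] with t ht using hmain t ht
    · exact hmain t ⟨ht, htb⟩
  · rw [cdf_eq_one_of_support hac hS (by linarith), cdf_map_eq_real hfmeas]
    have h1 : {x | f x ≤ t} = univ := eq_univ_of_forall fun x => (hfm x).2.trans htb
    rw [h1, probReal_univ]

lemma lambdaVar_eq_of_map_eq {α : Type*} [MeasurableSpace α] {ρ : Measure α} [SFinite ρ]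
    {g : α → ℝ} {lam : ℝ≥0 → ℝ≥0} (hlam : Continuous lam) (hg : Measurable g)
    (h : ρ.map g = ν.map (fun x => x - a)) : lambdaVar lam ρ g = lambdaVarMeasure lam ν := by
  rw [← lambdaVarMeasure_map hlam hg.aemeasurable, h,
    lambdaVarMeasure_map hlam (by fun_prop)]
  simp [lambdaVar, lambdaVarMeasure]

/-- Two bounded continuous functions with the same distribution, one of them at most the other,
are equal. -/
lemma eq_of_map_eq_of_le (hsupp : μ.support = univ) [CompactSpace X] {f g : X → ℝ}
    (hf : Continuous f) (hg : Continuous g) (hle : ∀ x, g x ≤ f x) (h : μ.map f = μ.map g) :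
    f = g := by
  have : μ.IsOpenPosMeasure := ⟨fun U hU ⟨x, hx⟩ =>
    ((Measure.mem_support_iff_forall x).1 (hsupp ▸ mem_univ x) U (hU.mem_nhds hx)).ne'⟩
  have hfi : Integrable f μ := hf.integrable_of_hasCompactSupport (.of_compactSpace f)
  have hgi : Integrable g μ := hg.integrable_of_hasCompactSupport (.of_compactSpace g)
  -- Equal laws give equal integrals, so the nonnegative difference vanishes almost everywhere; full
  -- support and continuity make this everywhere.
  have h1 : ∫ x, f x ∂μ = ∫ x, g x ∂μ := by
    have e1 := integral_map (μ := μ) hf.measurable.aemeasurable (f := fun y : ℝ => y)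
      (by fun_prop)
    have e2 := integral_map (μ := μ) hg.measurable.aemeasurable (f := fun y : ℝ => y)
      (by fun_prop)
    rw [← e1, ← e2, h]
  have h2 : ∫ x, (f x - g x) ∂μ = 0 := by rw [integral_sub hfi hgi, h1, sub_self]
  rw [integral_eq_zero_iff_of_nonneg (fun x => sub_nonneg.2 (hle x)) (hfi.sub hgi)] at h2
  refine (hf.ae_eq_iff_eq μ hg).1 ?_
  filter_upwards [h2] with x hx
  exact sub_eq_zero.1 hx

end Rigidity

/-! ### Gluing geodesics and non-branching -/

section Geodesics

variable {X : Type*} [MetricSpace X]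

lemma isMinimalGeodesic_of_lt {L : ℝ} {γ : ℝ → X}
    (h : ∀ s ∈ Icc 0 L, ∀ t ∈ Icc 0 L, s < t → dist (γ s) (γ t) = t - s) :
    IsMinimalGeodesic L γ := by
  intro s hs t ht
  rcases lt_trichotomy s t with hst | hst | hst
  · rw [h s hs t ht hst, abs_sub_comm, abs_of_pos (sub_pos.2 hst)]
  · simp [hst]
  · rw [dist_comm, h t ht s hs hst, abs_of_pos (sub_pos.2 hst)]

/-- Two curves, geodesic before and after the time `c`, form a minimal geodesic if they meet at
time `c` and the end points have the right distance. -/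
lemma IsMinimalGeodesic.glue {L c : ℝ} {γ σ : ℝ → X} (hc : c ∈ Icc 0 L)
    (hγ : ∀ s ∈ Icc 0 c, ∀ t ∈ Icc 0 c, dist (γ s) (γ t) = |s - t|)
    (hσ : ∀ s ∈ Icc c L, ∀ t ∈ Icc c L, dist (σ s) (σ t) = |s - t|)
    (hmeet : γ c = σ c) (hend : dist (γ 0) (σ L) = L) :
    IsMinimalGeodesic L (fun t => if t ≤ c then γ t else σ t) := by
  refine isMinimalGeodesic_of_lt fun s hs t ht hst => ?_
  by_cases htc : t ≤ c
  · simp only [hst.le.trans htc, htc, if_true]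
    rw [hγ s ⟨hs.1, hst.le.trans htc⟩ t ⟨ht.1, htc⟩, abs_sub_comm, abs_of_pos (sub_pos.2 hst)]
  push Not at htc
  by_cases hsc : s ≤ c
  · simp only [hsc, not_le.2 htc, if_true, if_false]
    have h1 : dist (γ s) (γ c) = c - s := by
      rw [hγ s ⟨hs.1, hsc⟩ c ⟨hc.1, le_rfl⟩, abs_sub_comm, abs_of_nonneg (sub_nonneg.2 hsc)]
    have h2 : dist (γ c) (σ t) = t - c := by
      rw [hmeet, hσ c ⟨le_rfl, hc.2⟩ t ⟨htc.le, ht.2⟩, abs_sub_comm, abs_of_pos (sub_pos.2 htc)]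
    have h3 : dist (γ 0) (γ s) = s := by
      rw [hγ 0 ⟨le_rfl, hc.1⟩ s ⟨hs.1, hsc⟩, zero_sub, abs_neg, abs_of_nonneg hs.1]
    have h4 : dist (σ t) (σ L) = L - t := by
      rw [hσ t ⟨htc.le, ht.2⟩ L ⟨hc.2, le_rfl⟩, abs_sub_comm, abs_of_nonneg (sub_nonneg.2 ht.2)]
    -- Passing through the meeting point bounds the distance from above; the prescribed distance `L`
    -- of the end points bounds it from below.
    have h5 := dist_triangle (γ s) (γ c) (σ t)
    have h6 := dist_triangle4 (γ 0) (γ s) (σ t) (σ L)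
    linarith
  · push Not at hsc
    simp only [not_le.2 hsc, not_le.2 htc, if_false]
    rw [hσ s ⟨hsc.le, hs.2⟩ t ⟨htc.le, ht.2⟩, abs_sub_comm, abs_of_pos (sub_pos.2 hst)]

/-- Minimal geodesics from `p` to `x` and from `x` to `q` form one from `p` to `q`, if `x` lies
metrically between `p` and `q`. -/
lemma IsMinimalGeodesicJoining.concat {p x q : X} {γ σ : ℝ → X}
    (hγ : IsMinimalGeodesicJoining p x γ) (hσ : IsMinimalGeodesicJoining x q σ)
    (hx : dist p x + dist x q = dist p q) :
    ∃ η : ℝ → X, IsMinimalGeodesicJoining p q η ∧ (∀ t ≤ dist p x, η t = γ t) ∧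
      ∀ t ∈ Icc 0 (dist x q), η (dist p x + t) = σ t := by
  obtain ⟨hγ, hγ0, hγ1⟩ := hγ
  obtain ⟨hσ, hσ0, hσ1⟩ := hσ
  set c := dist p x with hc
  have hsub : dist p q - c = dist x q := by linarith
  have hend : σ (dist p q - c) = q := by rw [hsub, hσ1]
  have hmeet : γ c = σ (c - c) := by rw [sub_self, hγ1, hσ0]
  set η : ℝ → X := fun t => if t ≤ c then γ t else σ (t - c) with hη
  have hησ : ∀ t ∈ Icc 0 (dist x q), η (c + t) = σ t := by
    intro t ht
    rcases ht.1.eq_or_lt with h0 | h0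
    · simp only [hη, ← h0, add_zero, le_refl, if_true, hγ1, hσ0]
    · simp only [hη]
      rw [if_neg (by linarith), add_sub_cancel_left]
  refine ⟨η, ⟨?_, ?_, ?_⟩, fun t ht => if_pos ht, hησ⟩
  · refine IsMinimalGeodesic.glue (σ := fun t => σ (t - c))
      ⟨dist_nonneg, by linarith [dist_nonneg (x := x) (y := q)]⟩ hγ ?_ hmeet ?_
    · intro s hs t ht
      rw [hσ (s - c) ⟨by linarith [hs.1], by linarith [hs.2]⟩ (t - c)
        ⟨by linarith [ht.1], by linarith [ht.2]⟩]
      congr 1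
      ring
    · rw [hγ0, hend]
  · simp only [hη]
    rw [if_pos dist_nonneg, hγ0]
  · rw [← hx, hησ _ ⟨dist_nonneg, le_rfl⟩, hσ1]

lemma IsGeodesicSpace.exists_joining_through (hX : IsGeodesicSpace X) {p x q : X}
    (hx : dist p x + dist x q = dist p q) :
    ∃ γ : ℝ → X, IsMinimalGeodesicJoining p q γ ∧ γ (dist p x) = x := by
  obtain ⟨γ, hγ⟩ := hX p x
  obtain ⟨σ, hσ⟩ := hX x q
  obtain ⟨η, h1, h2, -⟩ := hγ.concat hσ hx
  exact ⟨η, h1, (h2 _ le_rfl).trans hγ.2.2⟩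

lemma IsGeodesicSpace.exists_joining_through₂ (hX : IsGeodesicSpace X) {p x y q : X}
    (h : dist p x + dist x y + dist y q = dist p q) :
    ∃ γ : ℝ → X, IsMinimalGeodesicJoining p q γ ∧ γ (dist p x) = x ∧
      γ (dist p x + dist x y) = y := by
  have h1 := dist_triangle p x q
  have h2 := dist_triangle x y q
  obtain ⟨γ, hγ⟩ := hX p x
  obtain ⟨σ, hσ, hσy⟩ := hX.exists_joining_through (p := x) (x := y) (q := q) (by linarith)
  obtain ⟨η, h3, h4, h5⟩ := hγ.concat hσ (by linarith)
  refine ⟨η, h3, (h4 _ le_rfl).trans hγ.2.2, ?_⟩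
  rw [h5 _ ⟨dist_nonneg, by linarith [dist_nonneg (x := y) (y := q)]⟩, hσy]

lemma IsMinimalGeodesic.reverse {L : ℝ} {γ : ℝ → X} (hγ : IsMinimalGeodesic L γ) :
    IsMinimalGeodesic L (fun t => γ (L - t)) := by
  intro s hs t ht
  rw [hγ (L - s) ⟨by linarith [hs.2], by linarith [hs.1]⟩ (L - t)
    ⟨by linarith [ht.2], by linarith [ht.1]⟩, abs_sub_comm]
  congr 1
  ring

/-- Following `γ` up to time `c` and `σ` afterwards is again a minimal geodesic; it shares an
initial segment with `γ`, so it equals `γ`. -/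
lemma IsNonBranching.eq_after (hX : IsNonBranching X) {L c : ℝ} {γ σ : ℝ → X}
    (hγ : IsMinimalGeodesic L γ) (hσ : IsMinimalGeodesic L σ) (h0 : γ 0 = σ 0)
    (hc : c ∈ Ioo 0 L) (hmeet : γ c = σ c) {t : ℝ} (ht : t ∈ Icc c L) : γ t = σ t := by
  have hL : 0 ≤ L := (hc.1.trans hc.2).le
  have hglue := IsMinimalGeodesic.glue (Ioo_subset_Icc_self hc)
    (fun s hs t ht => hγ s ⟨hs.1, hs.2.trans hc.2.le⟩ t ⟨ht.1, ht.2.trans hc.2.le⟩)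
    (fun s hs t ht => hσ s ⟨hc.1.le.trans hs.1, hs.2⟩ t ⟨hc.1.le.trans ht.1, ht.2⟩) hmeet
    (by rw [h0, hσ 0 ⟨le_rfl, hL⟩ L ⟨hL, le_rfl⟩, zero_sub, abs_neg, abs_of_nonneg hL])
  have h := hX L _ _ hγ hglue c hc (fun t ht => (if_pos ht.2).symm) t ⟨hc.1.le.trans ht.1, ht.2⟩
  rcases ht.1.eq_or_lt with h' | h'
  · rw [← h', hmeet]
  · rw [h, if_neg (not_le.2 h')]

/-- In a non-branching space, minimal geodesics with common end points are disjoint in between. -/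
lemma IsNonBranching.eq_of_meet (hX : IsNonBranching X) {p q : X} {c : ℝ} {γ σ : ℝ → X}
    (hγ : IsMinimalGeodesicJoining p q γ) (hσ : IsMinimalGeodesicJoining p q σ)
    (hc : c ∈ Ioo 0 (dist p q)) (hmeet : γ c = σ c) {t : ℝ} (ht : t ∈ Icc 0 (dist p q)) :
    γ t = σ t := by
  rcases le_total c t with hct | hct
  · exact hX.eq_after hγ.1 hσ.1 (hγ.2.1.trans hσ.2.1.symm) hc hmeet ⟨hct, ht.2⟩
  · have h := hX.eq_after (c := dist p q - c) (t := dist p q - t) hγ.1.reverse hσ.1.reverse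
      (by simp only [sub_zero, hγ.2.2, hσ.2.2]) ⟨by linarith [hc.2], by linarith [hc.1]⟩
      (by simpa using hmeet) ⟨by linarith, by linarith [ht.1]⟩
    simpa using h

lemma IsMinimalGeodesicJoining.dist_left {p q : X} {γ : ℝ → X}
    (hγ : IsMinimalGeodesicJoining p q γ) {t : ℝ} (ht : t ∈ Icc 0 (dist p q)) :
    dist p (γ t) = t := by
  have h := hγ.1 0 ⟨le_rfl, dist_nonneg⟩ t ht
  rwa [hγ.2.1, zero_sub, abs_neg, abs_of_nonneg ht.1] at h

end Geodesics

/-! ### The suspension structure -/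

section Suspension

/-- The preimage of a closed set is the projection of a closed part of the graph along a compact
factor. -/
lemma continuous_of_isClosed_graph_of_compactSpace {A B : Type*} [TopologicalSpace A]
    [TopologicalSpace B] [CompactSpace B] {f : A → B} (h : IsClosed {z : A × B | f z.1 = z.2}) :
    Continuous f := by
  rw [continuous_iff_isClosed]
  intro C hC
  have h1 := isClosedMap_fst_of_compactSpace (X := A) (Y := B) _
    (h.inter (hC.preimage continuous_snd))
  convert h1
  ext x
  constructor
  · intro hx
    exact ⟨(x, f x), ⟨rfl, hx⟩, rfl⟩
  · rintro ⟨⟨y, z⟩, ⟨h2, h3⟩, rfl⟩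
    simp only [mem_ofPred_eq] at h2
    rw [mem_preimage, h2]
    exact h3

variable {X : Type*} [MetricSpace X] [CompactSpace X]

/-- The base is the level set midway between `p` and `q`, and `(y, t)` goes to the point at time `t
* D` on the geodesic through `y`. This descends to a continuous bijection from a compact space to a
Hausdorff one. -/
theorem isHomeomorphicToSuspension_of_isNonBranching (hX : IsGeodesicSpace X)
    (hnb : IsNonBranching X) {p q : X} (hD : 0 < dist p q)
    (hpq : ∀ x, dist p x + dist x q = dist p q) : IsHomeomorphicToSuspension X := by
  set D := dist p q with hDdef
  set Y : Set X := {y | dist p y = D / 2} with hY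
  have hYc : IsClosed Y := isClosed_eq (by fun_prop) continuous_const
  have : CompactSpace Y := isCompact_iff_compactSpace.1 hYc.isCompact
  have hΓ : ∀ y : Y, ∃ γ : ℝ → X, IsMinimalGeodesicJoining p q γ ∧ γ (D / 2) = y := by
    intro y
    obtain ⟨γ, h1, h2⟩ := hX.exists_joining_through (hpq y)
    have hy : dist p (y : X) = D / 2 := y.2
    exact ⟨γ, h1, by rw [hy] at h2; exact h2⟩
  choose Γ hΓ hΓy using hΓ
  have hhalf : D / 2 ∈ Ioo 0 D := ⟨by linarith, by linarith⟩
  have htD : ∀ t : unitInterval, (t : ℝ) * D ∈ Icc 0 D := fun t =>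
    ⟨mul_nonneg t.2.1 hD.le, mul_le_of_le_one_left hD.le t.2.2⟩
  let Φ : Y × unitInterval → X := fun z => Γ z.1 (z.2 * D)
  have hdist : ∀ z, dist p (Φ z) = z.2 * D := fun z => (hΓ z.1).dist_left (htD z.2)
  -- Distances alone determine the graph of `Φ`, so it is closed. If `x` satisfies both equations,
  -- some geodesic from `p` to `q` passes through `x` and `y`, and non-branching identifies it with
  -- `Γ y`.
  have hgraph : ∀ (z : Y × unitInterval) (x : X),
      Φ z = x ↔ dist p x = z.2 * D ∧ dist x z.1 = |z.2 * D - D / 2| := by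
    rintro ⟨y, t⟩ x
    constructor
    · rintro rfl
      refine ⟨hdist _, ?_⟩
      rw [← hΓy y]
      exact (hΓ y).1 _ (htD t) _ (Ioo_subset_Icc_self hhalf)
    · rintro ⟨h1, h2⟩
      simp only at h1 h2
      have hy : dist p (y : X) = D / 2 := y.2
      have hyq := hpq y
      have hxq := hpq x
      rcases le_total ((t : ℝ) * D) (D / 2) with h | h
      · rw [abs_of_nonpos (by linarith)] at h2
        obtain ⟨η, h3, h4, h5⟩ := hX.exists_joining_through₂ (p := p) (x := x) (y := y) (q := q)
          (by linarith)
        rw [h1, h2, show (t : ℝ) * D + -(t * D - D / 2) = D / 2 by ring] at h5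
        have h6 := hnb.eq_of_meet h3 (hΓ y) hhalf (h5.trans (hΓy y).symm) (htD t)
        rw [h1] at h4
        exact h6.symm.trans h4
      · rw [abs_of_nonneg (by linarith)] at h2
        rw [dist_comm] at h2
        obtain ⟨η, h3, h4, h5⟩ := hX.exists_joining_through₂ (p := p) (x := y) (y := x) (q := q)
          (by linarith)
        rw [hy, h2, show D / 2 + ((t : ℝ) * D - D / 2) = t * D by ring] at h5
        rw [hy] at h4
        have h6 := hnb.eq_of_meet h3 (hΓ y) hhalf (h4.trans (hΓy y).symm) (htD t)
        exact h6.symm.trans h5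
  have hΦc : Continuous Φ := by
    refine continuous_of_isClosed_graph_of_compactSpace ?_
    simp only [hgraph]
    exact (isClosed_eq (by fun_prop) (by fun_prop)).inter (isClosed_eq (by fun_prop) (by fun_prop))
  let Ψ : Suspension Y → X := Quot.lift Φ (by
    rintro ⟨y, t⟩ ⟨y', t'⟩ (⟨h1, h2⟩ | ⟨h1, h2⟩)
    · simp only at h1 h2
      simp only [Φ, h1, h2, Set.Icc.coe_zero, zero_mul, (hΓ y).2.1, (hΓ y').2.1]
    · simp only at h1 h2
      simp only [Φ, h1, h2, Set.Icc.coe_one, one_mul]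
      exact (hΓ y).2.2.trans (hΓ y').2.2.symm)
  have hΨc : Continuous Ψ := continuous_quot_lift _ hΦc
  have hbij : Function.Bijective Ψ := by
    constructor
    · rintro ⟨⟨y, t⟩⟩ ⟨⟨y', t'⟩⟩ h
      change Φ (y, t) = Φ (y', t') at h
      have htt : t = t' := by
        have h1 := hdist (y, t)
        rw [h, hdist] at h1
        exact Subtype.ext (mul_right_cancel₀ hD.ne' h1.symm)
      subst htt
      by_cases h0 : t = 0
      · exact Quot.sound (Or.inl ⟨h0, h0⟩)
      by_cases h1 : t = 1
      · exact Quot.sound (Or.inr ⟨h1, h1⟩)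
      have ht : (t : ℝ) * D ∈ Ioo 0 D :=
        ⟨mul_pos (unitInterval.pos_iff_ne_zero.2 h0) hD,
          mul_lt_of_lt_one_left hD (unitInterval.lt_one_iff_ne_one.2 h1)⟩
      have h2 := hnb.eq_of_meet (hΓ y) (hΓ y') ht h (Ioo_subset_Icc_self hhalf)
      rw [hΓy, hΓy] at h2
      rw [Subtype.ext h2]
    · intro x
      obtain ⟨γ, h1, h2⟩ := hX.exists_joining_through (hpq x)
      have hy : dist p (γ (D / 2)) = D / 2 := h1.dist_left (Ioo_subset_Icc_self hhalf)
      have hxD : dist p x ≤ D := by linarith [hpq x, dist_nonneg (x := x) (y := q)]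
      have hx : dist p x / D ∈ unitInterval :=
        ⟨div_nonneg dist_nonneg hD.le, (div_le_one hD).2 hxD⟩
      have hcancel : dist p x / D * D = dist p x := div_mul_cancel₀ _ hD.ne'
      refine ⟨Quot.mk _ (⟨γ (D / 2), hy⟩, ⟨dist p x / D, hx⟩), (hgraph _ _).2 ⟨?_, ?_⟩⟩
      · exact hcancel.symm
      · simp only [hcancel]
        have h3 := h1.1 (dist p x) ⟨dist_nonneg, hxD⟩ (D / 2) (Ioo_subset_Icc_self hhalf)
        rwa [h2] at h3
  exact ⟨Y, inferInstance,
    ⟨(Continuous.homeoOfEquivCompactToT2 (f := Equiv.ofBijective Ψ hbij) hΨc).symm⟩⟩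

end Suspension

/-! ### Every point lies between the ends of a diameter -/

section DistanceFunction

variable {X : Type*} [MetricSpace X] [MeasurableSpace X] [BorelSpace X] {μ : Measure X}
  [IsProbabilityMeasure μ] {ν : Measure ℝ} [IsProbabilityMeasure ν] {a b : ℝ}

/-- Both `dist p ·` and `b - a - dist · q` are 1-Lipschitz with maximal oscillation, hence equally
distributed; the triangle inequality makes the second at most the first. -/
lemma dist_add_dist_eq_of_satisfiesIC [CompactSpace X] (hsupp : μ.support = univ)
    (hconn : IsEssentiallyConnected μ) (hac : ν ≪ volume) (hab : a < b)
    (hS : ν.support = Icc a b) (hIC : SatisfiesIC μ ν) {p q : X} (hpq : dist p q = b - a)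
    (hdiam : ∀ x y : X, dist x y ≤ b - a) (x : X) : dist p x + dist x q = dist p q := by
  have hg : LipschitzWith 1 (fun x => b - a - dist x q) := by
    refine LipschitzWith.of_dist_le_mul fun x y => ?_
    rw [Real.dist_eq, NNReal.coe_one, one_mul, sub_sub_sub_cancel_left, abs_sub_comm]
    exact abs_dist_sub_le x y q
  have hf : LipschitzWith 1 (fun x => dist p x) := LipschitzWith.dist_right p
  have h1 := map_eq_map_sub_of_satisfiesIC hsupp hconn hac hab hS hIC hf
    (fun x => ⟨dist_nonneg, hdiam _ _⟩) (p := p) (q := q) (dist_self p) hpq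
  have h2 := map_eq_map_sub_of_satisfiesIC hsupp hconn hac hab hS hIC hg
    (fun x => ⟨sub_nonneg.2 (hdiam _ _), sub_le_self _ dist_nonneg⟩) (p := p) (q := q)
    (by rw [hpq, sub_self]) (by rw [dist_self, sub_zero])
  have h3 := eq_of_map_eq_of_le hsupp hf.continuous hg.continuous
    (fun x => by linarith [dist_triangle p x q]) (h1.trans h2.symm)
  have h4 : dist p x = b - a - dist x q := congrFun h3 x
  linarith

end DistanceFunction

/-! ### The main theorem -/

theorem theorem1p4 {X : Type*} [MetricSpace X] [CompactSpace X]
    [MeasurableSpace X] [BorelSpace X] (μ : Measure X) [IsProbabilityMeasure μ]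
    (hsupp : μ.support = Set.univ)
    (hgeod : IsGeodesicSpace X)
    (hconn : IsEssentiallyConnected μ)
    (ν : Measure ℝ) (hν : MemClassV ν) (hνc : IsCompact ν.support)
    (hIC : SatisfiesIC μ ν) :
    Metric.diam (Set.univ : Set X) ≤ Metric.diam ν.support ∧
    (∀ lam : ℝ≥0 → ℝ≥0, StrictMono lam → Continuous lam →
      (Metric.diam (Set.univ : Set X) = Metric.diam ν.support ↔
        obsVar lam μ = lambdaVarMeasure lam ν)) ∧
    (Metric.diam (Set.univ : Set X) = Metric.diam ν.support →
      IsCoveredByMaximalGeodesics X) := by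
  have := hν.isProbabilityMeasure
  have hac := hν.absolutelyContinuous
  obtain ⟨a, b, hab, hS⟩ := hν.exists_support_eq_Icc hνc
  have hdν : Metric.diam ν.support = b - a := by rw [hS, Real.diam_Icc hab.le]
  have : Nonempty X := nonempty_of_isProbabilityMeasure μ
  have hbdd : Bornology.IsBounded (univ : Set X) := isCompact_univ.isBounded
  have hdist : ∀ x y : X, dist x y ≤ Metric.diam (univ : Set X) := fun x y =>
    Metric.dist_le_diam_of_mem hbdd (mem_univ x) (mem_univ y)
  obtain ⟨⟨p, q⟩, hpq⟩ : ∃ z : X × X, dist z.1 z.2 = Metric.diam (univ : Set X) := by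
    obtain ⟨z, -, hz⟩ := isCompact_univ.exists_isMaxOn univ_nonempty
      (f := fun z : X × X => dist z.1 z.2) (by fun_prop)
    exact ⟨z, le_antisymm (hdist _ _) (Metric.diam_le_of_forall_dist_le dist_nonneg
      fun x _ y _ => hz (mem_univ (x, y)))⟩
  simp only at hpq
  have hLip : LipschitzWith 1 (fun x => dist p x) := LipschitzWith.dist_right p
  have hle : Metric.diam (univ : Set X) ≤ b - a := by
    have h := sub_le_of_satisfiesIC hsupp hconn hac hab hS hIC hLip p q
    simpa [hpq] using h
  rw [hdν]
  refine ⟨hle, fun lam hmono hlam => ?_, fun heq => ?_⟩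
  · obtain ⟨D, hD⟩ : ∃ D : ℝ≥0, (D : ℝ) = Metric.diam (univ : Set X) :=
      ⟨NNReal.mk _ Metric.diam_nonneg, NNReal.coe_mk _ _⟩
    -- This truncated bound serves both directions: dropping the truncation gives the upper bound in
    -- the equality case, and its strictness for `D < b - a` gives the converse.
    have hupper : obsVar lam μ ≤
        ∫⁻ x', ∫⁻ x, (lam (min (nndist x x') D) : ℝ≥0∞) ∂ν ∂ν := by
      refine iSup₂_le fun f hf => ?_
      obtain ⟨z, -, hz⟩ := isCompact_univ.exists_isMinOn univ_nonempty hf.continuous.continuousOn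
      refine lambdaVar_le_of_satisfiesIC hconn hac hab hS hIC hf hlam hmono.monotone (m := f z)
        fun x => ⟨hz (mem_univ x), ?_⟩
      have h1 := hf.dist_le_mul x z
      rw [NNReal.coe_one, one_mul, Real.dist_eq] at h1
      linarith [le_abs_self (f x - f z), hdist x z]
    constructor
    · intro heq
      refine le_antisymm (hupper.trans ?_) ?_
      · exact lintegral_mono fun x' => lintegral_mono fun x =>
          ENNReal.coe_le_coe.2 (hmono.monotone (min_le_left _ _))
      · have h1 := map_eq_map_sub_of_satisfiesIC hsupp hconn hac hab hS hIC hLip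
          (fun x => ⟨dist_nonneg, (hdist _ _).trans hle⟩) (p := p) (q := q) (dist_self p)
          (hpq.trans heq)
        rw [← lambdaVar_eq_of_map_eq hlam hLip.continuous.measurable h1]
        exact le_iSup₂_of_le _ hLip le_rfl
    · intro h
      by_contra hne
      exact absurd h (hupper.trans_lt (lintegral_min_lt_lambdaVarMeasure hab hS hlam hmono
        (hD ▸ lt_of_le_of_ne hle hne))).ne
  · have hbetween := dist_add_dist_eq_of_satisfiesIC hsupp hconn hac hab hS hIC (hpq.trans heq)
      fun x y => (hdist x y).trans hle
    refine ⟨⟨p, q, hpq, fun x => ?_⟩, fun hnb => ?_⟩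
    · obtain ⟨γ, h1, h2⟩ := hgeod.exists_joining_through (hbetween x)
      exact ⟨γ, h1, dist p x, ⟨dist_nonneg, by linarith [hbetween x, dist_nonneg (x := x) (y := q)]⟩,
        h2⟩
    · exact isHomeomorphicToSuspension_of_isNonBranching hgeod hnb
        (by rw [hpq, heq]; linarith) hbetween
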